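/- Let $d \ge 1$ and let $\{A_{i,n} : 1 \le i \le n,\ n \in \mathbb{N}\} \subseteq M_d(\mathbb{C})$ be a triangular array of complex $d \times d$ matrices, where $M_d(\mathbb{C})$ carries the operator norm induced by the Euclidean norm on $\mathbb{C}^d$. Denote $$A_n = \frac1n \sum_{i=1}^n A_{i,n}, \qquad L^1_n = \frac1n \sum_{i=1}^n \|A_{i,n}\|, \qquad L^\infty_n = \max_{1 \le i \le n} \|A_{i,n}\|.$$ Let $(a_n)$ be a sequence of positive integers, $b_n = \lfloor n/a_n \rfloor$, and for $1 \le j \le b_n$ let $$V_{j,n} = \{(j-1)a_n + 1, \dots, (j-1)a_n + a_n\}.$$ Then for every $n \ge 1$ and every $\varepsilon$ with $0 < \varepsilon < 3 L^1_n$, if the permutation $\sigma \in S(n)$ is drawn uniformly at random, $$\mathbb{P}\left(\exists j,\ 1 \le j \le b_n : \left\| \frac{1}{a_n} \sum_{i \in V_{j,n}} A_{\sigma(i),n} - A_n \right\| > \varepsilon \right) \le 2\, d\, b_n \exp\left( - \frac{a_n \varepsilon^2}{12\, L^1_n L^\infty_n} \right).$$ -/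

import Mathlib

/- `Matrix (Fin d) (Fin d) ℂ` carries the operator norm induced by the Euclidean norm of `ℂ^d`. -/
open scoped Matrix.Norms.L2Operator

namespace RandomPerm

/-- The symmetric group `S(n)` carries the discrete sigma-algebra. -/
instance instMeasurableSpacePerm (n : ℕ) : MeasurableSpace (Equiv.Perm (Fin n)) := ⊤

/-- The uniform probability distribution on the symmetric group `S(n)`. -/
noncomputable def uniformPerm (n : ℕ) : MeasureTheory.Measure (Equiv.Perm (Fin n)) :=
  (PMF.uniformOfFintype (Equiv.Perm (Fin n))).toMeasure

/-- A triangular array `A_{i,n}` of complex `d × d` matrices: row `n` has `n` entries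
(indexed by `0, …, n - 1`). -/
abbrev TriArray (d : ℕ) : Type := (n : ℕ) → Fin n → Matrix (Fin d) (Fin d) ℂ

/-- The row average `A_n = (1/n) ∑ i, A_{i,n}`. -/
noncomputable def rowAvg {d : ℕ} (A : TriArray d) (n : ℕ) : Matrix (Fin d) (Fin d) ℂ :=
  (1 / (n : ℂ)) • ∑ i, A n i

/-- `L¹_n = (1/n) ∑ i, ‖A_{i,n}‖`. -/
noncomputable def LOne {d : ℕ} (A : TriArray d) (n : ℕ) : ℝ :=
  (1 / (n : ℝ)) * ∑ i, ‖A n i‖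

/-- `L^∞_n = max_i ‖A_{i,n}‖` (a supremum over a finite family). -/
noncomputable def LInf {d : ℕ} (A : TriArray d) (n : ℕ) : ℝ :=
  ⨆ i, ‖A n i‖

/-- The number of blocks `b_n = [n / a_n]` for the block length `a = a_n`. -/
def numBlocks (a n : ℕ) : ℕ := n / a

/-- The `j`-th block of `a` consecutive indices; with indices and blocks counted from `0` it is
`{j a, …, j a + a - 1}`. -/
def block (a n j : ℕ) : Finset (Fin n) :=
  Finset.univ.filter fun i => j * a ≤ (i : ℕ) ∧ (i : ℕ) < j * a + a

/-- The permuted block average `(1/a) ∑_{i ∈ V_j} A_{σ(i),n}` over the `j`-th block. -/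
noncomputable def blockAvg {d : ℕ} (A : TriArray d) (a n j : ℕ) (σ : Equiv.Perm (Fin n)) :
    Matrix (Fin d) (Fin d) ℂ :=
  (1 / (a : ℂ)) • ∑ i ∈ block a n j, A n (σ i)

end RandomPerm

/-!
A tail bound for the largest singular value of a matrix becomes, through its Hermitian dilation, a
bound for the mean of the trace exponential, by Markov's inequality. A sample without replacement is
the conditional mean of a sample with replacement that is randomly scrambled, and the trace
exponential is convex, so Hoeffding's comparison reduces the estimate to independent draws. For
these the Golden–Thompson inequality, a consequence of the Lie–Trotter formula, lets the draws be
integrated out one at a time, as in the argument of Ahlswede and Winter, each contributing a factor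
`exp (θ² v)`, where `v = L¹ L^∞` dominates the variance. The bound `exp y ≤ 1 + y + y²` behind that
factor needs `2 θ L^∞ ≤ 1`: with `θ = ε / (6 v)` this is `ε ≤ 3 L¹`, and the exponent per draw,
`θ² v - θ ε = -5 ε² / (36 v)`, is at most `-ε² / (12 v)`.
-/

namespace RandomPerm

open scoped BigOperators ComplexOrder MatrixOrder
open Filter Matrix NormedSpace Topology

section Trace

variable {𝕜 m n : Type*} [RCLike 𝕜] [Fintype m] [Fintype n]

theorem two_mul_re_trace_conjTranspose_mul_le (A B : Matrix m n 𝕜) :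
    2 * RCLike.re (trace (Aᴴ * B)) ≤
      RCLike.re (trace (Aᴴ * A)) + RCLike.re (trace (Bᴴ * B)) := by
  have nonneg : 0 ≤ RCLike.re (trace ((A - B)ᴴ * (A - B))) :=
    (RCLike.nonneg_iff.mp (posSemidef_conjTranspose_mul_self (A - B)).trace_nonneg).1
  have symm : RCLike.re (trace (Bᴴ * A)) = RCLike.re (trace (Aᴴ * B)) := by
    rw [← conjTranspose_conjTranspose (Bᴴ * A), trace_conjTranspose, conjTranspose_mul,
      conjTranspose_conjTranspose, RCLike.star_def, RCLike.conj_re]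
  simp only [conjTranspose_sub, Matrix.sub_mul, Matrix.mul_sub, trace_sub, map_sub, symm] at nonneg
  linarith

theorem re_trace_mul_nonneg {P Q : Matrix m m 𝕜} (hP : 0 ≤ P) (hQ : 0 ≤ Q) :
    0 ≤ RCLike.re (trace (P * Q)) := by
  classical
  obtain ⟨C, rfl⟩ := CStarAlgebra.nonneg_iff_eq_star_mul_self.mp hQ
  rw [← mul_assoc, trace_mul_comm, ← mul_assoc]
  exact (RCLike.nonneg_iff.mp (hP.posSemidef.mul_mul_conjTranspose_same C).trace_nonneg).1

variable [DecidableEq m]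

theorem re_trace_mul_le_of_le_algebraMap {P Q : Matrix m m 𝕜} {c : ℝ} (hP : 0 ≤ P)
    (hQ : Q ≤ algebraMap ℝ _ c) :
    RCLike.re (trace (P * Q)) ≤ c * RCLike.re (trace P) := by
  have nonneg := re_trace_mul_nonneg hP (sub_nonneg.mpr hQ)
  rw [mul_sub, Algebra.algebraMap_eq_smul_one, mul_smul_comm, mul_one, trace_sub, trace_smul,
    map_sub, RCLike.smul_re] at nonneg
  linarith

theorem trace_mul_pow_comm {R : Type*} [CommSemiring R] (A B : Matrix m m R) (k : ℕ) :
    trace ((A * B) ^ k) = trace ((B * A) ^ k) := by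
  cases k with
  | zero => simp
  | succ k =>
    have semiconj : SemiconjBy B (A * B) (B * A) := (mul_assoc B A B).symm
    rw [pow_succ', mul_assoc, trace_mul_comm, (semiconj.pow_right k).eq, mul_assoc, ← pow_succ]

theorem trace_conjTranspose_mul_self_pow {X Y : Matrix m m 𝕜} (hX : X.IsHermitian)
    (hY : Y.IsHermitian) (k : ℕ) :
    trace (((X * Y)ᴴ * (X * Y)) ^ k) = trace ((X ^ 2 * Y ^ 2) ^ k) := by
  rw [conjTranspose_mul, hX.eq, hY.eq, mul_assoc, trace_mul_pow_comm, sq, sq]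
  simp only [mul_assoc]

-- Neither half is inductive by itself: each is used at `k` to prove the other at `k + 1`.
theorem re_trace_two_pow_le (k : ℕ) :
    (∀ M : Matrix m m 𝕜,
      RCLike.re (trace (M ^ 2 ^ (k + 1))) ≤ RCLike.re (trace ((Mᴴ * M) ^ 2 ^ k))) ∧
    ∀ X Y : Matrix m m 𝕜, X.IsHermitian → Y.IsHermitian →
      RCLike.re (trace ((X * Y) ^ 2 ^ k)) ≤ RCLike.re (trace (X ^ 2 ^ k * Y ^ 2 ^ k)) := by
  induction k with
  | zero =>
    refine ⟨fun M => ?_, fun X Y _ _ => by simp⟩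
    have amgm := two_mul_re_trace_conjTranspose_mul_le Mᴴ M
    rw [conjTranspose_conjTranspose, trace_mul_comm M Mᴴ] at amgm
    simp only [zero_add, pow_one, pow_zero, sq]
    linarith
  | succ k ih =>
    obtain ⟨ihM, ihXY⟩ := ih
    constructor
    · intro M
      have hX : (Mᴴ * M).IsHermitian := isHermitian_conjTranspose_mul_self M
      have hY : (M * Mᴴ).IsHermitian := isHermitian_mul_conjTranspose_self M
      have regroup : (M ^ 2)ᴴ * M ^ 2 = Mᴴ * (Mᴴ * M * M) := by
        simp only [sq, conjTranspose_mul, mul_assoc]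
      have amgm := two_mul_re_trace_conjTranspose_mul_le ((Mᴴ * M) ^ 2 ^ k) ((M * Mᴴ) ^ 2 ^ k)
      rw [(hX.pow _).eq, (hY.pow _).eq, ← pow_add, ← pow_add, ← two_mul, ← pow_succ',
        trace_mul_pow_comm M Mᴴ] at amgm
      calc RCLike.re (trace (M ^ 2 ^ (k + 1 + 1)))
          = RCLike.re (trace ((M ^ 2) ^ 2 ^ (k + 1))) := by rw [← pow_mul, ← pow_succ']
        _ ≤ RCLike.re (trace (((M ^ 2)ᴴ * M ^ 2) ^ 2 ^ k)) := ihM (M ^ 2)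
        _ = RCLike.re (trace ((Mᴴ * M * (M * Mᴴ)) ^ 2 ^ k)) := by
            rw [regroup, trace_mul_pow_comm, mul_assoc]
        _ ≤ RCLike.re (trace ((Mᴴ * M) ^ 2 ^ k * (M * Mᴴ) ^ 2 ^ k)) := ihXY _ _ hX hY
        _ ≤ RCLike.re (trace ((Mᴴ * M) ^ 2 ^ (k + 1))) := by linarith
    · intro X Y hX hY
      calc RCLike.re (trace ((X * Y) ^ 2 ^ (k + 1)))
          ≤ RCLike.re (trace (((X * Y)ᴴ * (X * Y)) ^ 2 ^ k)) := ihM (X * Y)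
        _ = RCLike.re (trace ((X ^ 2 * Y ^ 2) ^ 2 ^ k)) := by
            rw [trace_conjTranspose_mul_self_pow hX hY]
        _ ≤ RCLike.re (trace ((X ^ 2) ^ 2 ^ k * (Y ^ 2) ^ 2 ^ k)) :=
            ihXY _ _ (hX.pow 2) (hY.pow 2)
        _ = RCLike.re (trace (X ^ 2 ^ (k + 1) * Y ^ 2 ^ (k + 1))) := by
            rw [← pow_mul, ← pow_mul, ← pow_succ']

theorem re_trace_mul_pow_two_pow_le {X Y : Matrix m m 𝕜} (hX : X.IsHermitian)
    (hY : Y.IsHermitian) (k : ℕ) :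
    RCLike.re (trace ((X * Y) ^ 2 ^ k)) ≤ RCLike.re (trace (X ^ 2 ^ k * Y ^ 2 ^ k)) :=
  (re_trace_two_pow_le k).2 X Y hX hY

end Trace

section LieTrotter

variable {𝔸 : Type*} [NormedRing 𝔸]

theorem norm_pow_sub_pow_le [NormOneClass 𝔸] {x y : 𝔸} {c : ℝ} (hx : ‖x‖ ≤ c)
    (hy : ‖y‖ ≤ c) (n : ℕ) :
    ‖x ^ n - y ^ n‖ ≤ n * c ^ (n - 1) * ‖x - y‖ := by
  have hc : 0 ≤ c := (norm_nonneg x).trans hx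
  induction n with
  | zero => simp
  | succ n ih =>
    have telescope : x ^ (n + 1) - y ^ (n + 1) = x * (x ^ n - y ^ n) + (x - y) * y ^ n := by
      rw [pow_succ' x, pow_succ' y]; noncomm_ring
    have absorb : c * (n * c ^ (n - 1)) = n * c ^ n := by
      cases n with
      | zero => simp
      | succ n => rw [Nat.add_sub_cancel, pow_succ]; ring
    calc ‖x ^ (n + 1) - y ^ (n + 1)‖
        ≤ ‖x‖ * ‖x ^ n - y ^ n‖ + ‖x - y‖ * ‖y‖ ^ n := by
          rw [telescope]
          refine (norm_add_le _ _).trans (add_le_add (norm_mul_le _ _) ?_)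
          exact (norm_mul_le _ _).trans (by gcongr; exact norm_pow_le _ _)
      _ ≤ c * (n * c ^ (n - 1) * ‖x - y‖) + ‖x - y‖ * c ^ n := by gcongr
      _ = (n + 1 : ℕ) * c ^ (n + 1 - 1) * ‖x - y‖ := by
          rw [← mul_assoc, absorb, Nat.add_sub_cancel]; push_cast; ring

variable [NormedAlgebra ℝ 𝔸]

theorem norm_exp_le [NormOneClass 𝔸] (x : 𝔸) : ‖exp x‖ ≤ Real.exp ‖x‖ := by
  rw [exp_eq_tsum ℝ, Real.exp_eq_exp_ℝ, exp_eq_tsum ℝ]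
  refine tsum_of_norm_bounded (expSeries_summable' (𝕂 := ℝ) ‖x‖).hasSum fun n => ?_
  rw [norm_smul, smul_eq_mul, Real.norm_of_nonneg (by positivity)]
  gcongr
  exact norm_pow_le _ _

theorem norm_exp_smul_le [NormOneClass 𝔸] {t : ℝ} (ht : 0 ≤ t) (A : 𝔸) :
    ‖exp (t • A)‖ ≤ Real.exp (t * ‖A‖) :=
  (norm_exp_le _).trans_eq (by rw [norm_smul, Real.norm_of_nonneg ht])

variable [CompleteSpace 𝔸]

theorem hasDerivAt_exp_smul_mul_exp_smul_sub_exp_smul_add (A B : 𝔸) :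
    HasDerivAt (fun t : ℝ => exp (t • A) * exp (t • B) - exp (t • (A + B))) 0 0 := by
  have hderiv := ((hasDerivAt_exp_smul_const A (0 : ℝ)).mul
    (hasDerivAt_exp_smul_const B (0 : ℝ))).sub (hasDerivAt_exp_smul_const (A + B) (0 : ℝ))
  simp only [zero_smul, exp_zero, one_mul, mul_one, sub_self] at hderiv
  exact hderiv

theorem exp_inv_smul_pow (A : 𝔸) {n : ℕ} (hn : n ≠ 0) : exp ((n : ℝ)⁻¹ • A) ^ n = exp A := by
  let _ : NormedAlgebra ℚ 𝔸 := .restrictScalars ℚ ℝ 𝔸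
  rw [← NormedSpace.exp_nsmul, ← Nat.cast_smul_eq_nsmul ℝ, smul_inv_smul₀ (Nat.cast_ne_zero.mpr hn)]

variable [NormOneClass 𝔸]

theorem norm_exp_mul_exp_pow_sub_exp_add_le (A B : 𝔸) {n : ℕ} (hn : n ≠ 0) :
    ‖(exp ((n : ℝ)⁻¹ • A) * exp ((n : ℝ)⁻¹ • B)) ^ n - exp (A + B)‖ ≤
      Real.exp (‖A‖ + ‖B‖) *
        (n * ‖exp ((n : ℝ)⁻¹ • A) * exp ((n : ℝ)⁻¹ • B) - exp ((n : ℝ)⁻¹ • (A + B))‖) := by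
  set t : ℝ := (n : ℝ)⁻¹
  have ht0 : 0 ≤ t := by positivity
  have hprod : ‖exp (t • A) * exp (t • B)‖ ≤ Real.exp (t * (‖A‖ + ‖B‖)) := by
    rw [mul_add, Real.exp_add]
    exact (norm_mul_le _ _).trans (by gcongr <;> exact norm_exp_smul_le ht0 _)
  have hsum : ‖exp (t • (A + B))‖ ≤ Real.exp (t * (‖A‖ + ‖B‖)) :=
    (norm_exp_smul_le ht0 _).trans (by gcongr; exact norm_add_le _ _)
  have hpow : Real.exp (t * (‖A‖ + ‖B‖)) ^ (n - 1) ≤ Real.exp (‖A‖ + ‖B‖) := by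
    rw [← Real.exp_nat_mul, ← mul_assoc]
    refine Real.exp_le_exp.mpr (mul_le_of_le_one_left (by positivity) ?_)
    calc ((n - 1 : ℕ) : ℝ) * t ≤ n * t := by gcongr; exact Nat.sub_le n 1
      _ = 1 := mul_inv_cancel₀ (Nat.cast_ne_zero.mpr hn)
  calc _ ≤ n * Real.exp (t * (‖A‖ + ‖B‖)) ^ (n - 1) *
        ‖exp (t • A) * exp (t • B) - exp (t • (A + B))‖ := by
        rw [← exp_inv_smul_pow (A + B) hn]
        exact norm_pow_sub_pow_le hprod hsum n
    _ ≤ n * Real.exp (‖A‖ + ‖B‖) * ‖exp (t • A) * exp (t • B) - exp (t • (A + B))‖ := by gcongr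
    _ = _ := by ring

theorem tendsto_exp_mul_exp_pow (A B : 𝔸) :
    Tendsto (fun n : ℕ => (exp ((n : ℝ)⁻¹ • A) * exp ((n : ℝ)⁻¹ • B)) ^ n) atTop
      (𝓝 (exp (A + B))) := by
  have hinv : Tendsto (fun n : ℕ => (n : ℝ)⁻¹) atTop (𝓝[≠] 0) :=
    tendsto_nhdsWithin_iff.mpr ⟨tendsto_inv_atTop_nhds_zero_nat,
      (eventually_ne_atTop 0).mono fun n hn => inv_ne_zero (Nat.cast_ne_zero.mpr hn)⟩
  have hslope := (hasDerivAt_iff_tendsto_slope_zero.mp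
    (hasDerivAt_exp_smul_mul_exp_smul_sub_exp_smul_add A B)).comp hinv
  have hbound := hslope.norm.const_mul (Real.exp (‖A‖ + ‖B‖))
  rw [norm_zero, mul_zero] at hbound
  rw [tendsto_iff_norm_sub_tendsto_zero]
  refine squeeze_zero' (.of_forall fun _ => norm_nonneg _)
    ((eventually_ne_atTop 0).mono fun n hn => ?_) hbound
  simpa [norm_smul] using norm_exp_mul_exp_pow_sub_exp_add_le A B hn

end LieTrotter

section GoldenThompson

variable {m : Type*} [Fintype m] [DecidableEq m]

theorem re_trace_exp_add_le {A B : Matrix m m ℂ} (hA : A.IsHermitian) (hB : B.IsHermitian) :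
    (trace (exp (A + B))).re ≤ (trace (exp A * exp B)).re := by
  cases isEmpty_or_nonempty m with
  | inl h => simp [trace]
  | inr h =>
    have hcont : Continuous fun M : Matrix m m ℂ => (trace M).re :=
      Complex.continuous_re.comp continuous_id.matrix_trace
    have htwo : Tendsto (fun k : ℕ => 2 ^ k) atTop atTop :=
      tendsto_pow_atTop_atTop_of_one_lt one_lt_two
    have hlim := (hcont.tendsto _).comp ((tendsto_exp_mul_exp_pow A B).comp htwo)
    refine le_of_tendsto hlim (.of_forall fun k => ?_)
    have hexp {C : Matrix m m ℂ} (hC : C.IsHermitian) :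
        (exp (((2 ^ k : ℕ) : ℝ)⁻¹ • C)).IsHermitian :=
      IsHermitian.exp (IsSelfAdjoint.smul (.all _) hC)
    calc (trace ((exp (((2 ^ k : ℕ) : ℝ)⁻¹ • A) * exp (((2 ^ k : ℕ) : ℝ)⁻¹ • B)) ^ 2 ^ k)).re
        ≤ (trace (exp (((2 ^ k : ℕ) : ℝ)⁻¹ • A) ^ 2 ^ k *
            exp (((2 ^ k : ℕ) : ℝ)⁻¹ • B) ^ 2 ^ k)).re :=
          re_trace_mul_pow_two_pow_le (hexp hA) (hexp hB) k
      _ = (trace (exp A * exp B)).re := by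
          rw [exp_inv_smul_pow A (by positivity), exp_inv_smul_pow B (by positivity)]

end GoldenThompson

section TraceConvexity

variable {𝕜 m : Type*} [RCLike 𝕜] [Fintype m] [DecidableEq m]

theorem sum_norm_sq_apply_eq_one {U : Matrix m m 𝕜} (hU : star U * U = 1) (i : m) :
    ∑ j, ‖U j i‖ ^ 2 = 1 := by
  have h : (star U * U) i i = 1 := by rw [hU, one_apply_eq]
  simp only [mul_apply, star_apply, RCLike.star_def, RCLike.conj_mul] at h
  exact_mod_cast h

theorem re_star_mul_cfc_mul_apply_self {K : Matrix m m 𝕜} (hK : K.IsHermitian) (f : ℝ → ℝ)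
    (U : Matrix m m 𝕜) (i : m) :
    RCLike.re ((star U * cfc f K * U) i i) =
      ∑ j, ‖(star (hK.eigenvectorUnitary : Matrix m m 𝕜) * U) j i‖ ^ 2 * f (hK.eigenvalues j) := by
  set W := star (hK.eigenvectorUnitary : Matrix m m 𝕜) * U with hW
  have diagonalize :
      star U * cfc f K * U = star W * diagonal (RCLike.ofReal ∘ f ∘ hK.eigenvalues) * W := by
    simp only [hK.cfc_eq, IsHermitian.cfc, Unitary.conjStarAlgAut_apply, hW, star_mul, star_star,
      mul_assoc]
  rw [diagonalize, mul_apply, map_sum]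
  refine Finset.sum_congr rfl fun j _ => ?_
  rw [mul_diagonal, star_apply, RCLike.star_def, mul_right_comm, RCLike.conj_mul]
  simp only [Function.comp_apply]
  norm_cast

theorem re_trace_cfc {K : Matrix m m 𝕜} (hK : K.IsHermitian) (f : ℝ → ℝ) :
    RCLike.re (trace (cfc f K)) = ∑ i, f (hK.eigenvalues i) := by
  rw [hK.cfc_eq, IsHermitian.cfc, Unitary.conjStarAlgAut_apply, trace_mul_cycle,
    Unitary.coe_star_mul_self, one_mul, trace_diagonal, map_sum]
  exact Finset.sum_congr rfl fun i _ => RCLike.ofReal_re _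

theorem le_re_trace_cfc {K : Matrix m m 𝕜} (hK : K.IsHermitian) {f : ℝ → ℝ} (hf : ∀ x, 0 ≤ f x)
    {r : ℝ} (hr : r ∈ spectrum ℝ K) : f r ≤ RCLike.re (trace (cfc f K)) := by
  rw [hK.spectrum_real_eq_range_eigenvalues] at hr
  obtain ⟨i, rfl⟩ := hr
  rw [re_trace_cfc hK]
  exact Finset.single_le_sum (f := fun i => f (hK.eigenvalues i)) (fun i _ => hf _)
    (Finset.mem_univ i)

theorem sum_map_re_star_mul_mul_apply_self_le {K : Matrix m m 𝕜} (hK : K.IsHermitian) {f : ℝ → ℝ}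
    (hf : ConvexOn ℝ Set.univ f) (U : unitaryGroup m 𝕜) :
    ∑ i, f (RCLike.re ((star (U : Matrix m m 𝕜) * K * U) i i)) ≤ RCLike.re (trace (cfc f K)) := by
  set w : m → m → ℝ := fun i j =>
    ‖(star (hK.eigenvectorUnitary : Matrix m m 𝕜) * (U : Matrix m m 𝕜)) j i‖ ^ 2
  have hsum (i : m) : ∑ j, w i j = 1 :=
    sum_norm_sq_apply_eq_one (Unitary.coe_star_mul_self (star hK.eigenvectorUnitary * U)) i
  have hdiag (i : m) : RCLike.re ((star (U : Matrix m m 𝕜) * K * U) i i) =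
      ∑ j, w i j * hK.eigenvalues j := by
    have h := re_star_mul_cfc_mul_apply_self hK id (U : Matrix m m 𝕜) i
    rwa [cfc_id ℝ K hK.isSelfAdjoint] at h
  have htrace : RCLike.re (trace (cfc f K)) = ∑ i, ∑ j, w i j * f (hK.eigenvalues j) := by
    calc RCLike.re (trace (cfc f K))
        = RCLike.re (trace (star (U : Matrix m m 𝕜) * cfc f K * (U : Matrix m m 𝕜))) := by
          rw [trace_mul_cycle, Unitary.mul_star_self_of_mem U.2, one_mul]
      _ = ∑ i, ∑ j, w i j * f (hK.eigenvalues j) := by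
          rw [trace, map_sum]
          exact Finset.sum_congr rfl fun i _ => re_star_mul_cfc_mul_apply_self hK f U i
  rw [htrace]
  refine Finset.sum_le_sum fun i _ => ?_
  rw [hdiag]
  simpa only [smul_eq_mul] using
    hf.map_sum_le (fun j _ => sq_nonneg _) (hsum i) fun j _ => Set.mem_univ (hK.eigenvalues j)

theorem convexOn_re_trace_cfc {f : ℝ → ℝ} (hf : ConvexOn ℝ Set.univ f) :
    ConvexOn ℝ {K : Matrix m m 𝕜 | K.IsHermitian} fun K => RCLike.re (trace (cfc f K)) := by
  have hconvex : Convex ℝ {K : Matrix m m 𝕜 | K.IsHermitian} := fun A hA B hB s t _ _ _ =>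
    (IsSelfAdjoint.smul (.all s) hA).add (IsSelfAdjoint.smul (.all t) hB)
  refine ⟨hconvex, fun A hA B hB s t hs ht hst => ?_⟩
  have hH : (s • A + t • B).IsHermitian := hconvex hA hB hs ht hst
  set U := hH.eigenvectorUnitary
  set diag : Matrix m m 𝕜 → m → ℝ := fun K i =>
    RCLike.re ((star (U : Matrix m m 𝕜) * K * U) i i) with hdiag
  have heigenvalues (i : m) : hH.eigenvalues i = s * diag A i + t * diag B i := by
    have h := hH.conjStarAlgAut_star_eigenvectorUnitary
    rw [Unitary.conjStarAlgAut_star_apply] at h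
    have hi := congrArg (fun M : Matrix m m 𝕜 => RCLike.re (M i i)) h
    simpa [hdiag, mul_add, add_mul, RCLike.smul_re] using hi.symm
  calc RCLike.re (trace (cfc f (s • A + t • B)))
      = ∑ i, f (s * diag A i + t * diag B i) := by
        rw [re_trace_cfc hH]; simp only [heigenvalues]
    _ ≤ ∑ i, (s * f (diag A i) + t * f (diag B i)) :=
        Finset.sum_le_sum fun i _ => hf.2 (Set.mem_univ _) (Set.mem_univ _) hs ht hst
    _ = s * ∑ i, f (diag A i) + t * ∑ i, f (diag B i) := by
        rw [Finset.sum_add_distrib, Finset.mul_sum, Finset.mul_sum]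
    _ ≤ s * RCLike.re (trace (cfc f A)) + t * RCLike.re (trace (cfc f B)) := by
        gcongr
        · exact sum_map_re_star_mul_mul_apply_self_le hA hf U
        · exact sum_map_re_star_mul_mul_apply_self_le hB hf U

theorem convexOn_re_trace_exp :
    ConvexOn ℝ {K : Matrix m m ℂ | K.IsHermitian} fun K => (trace (exp K)).re :=
  (convexOn_re_trace_cfc convexOn_exp).congr fun K (hK : IsSelfAdjoint K) => by
    simp only [CFC.real_exp_eq_normedSpace_exp hK, RCLike.re_eq_complex_re]

theorem exp_le_re_trace_exp {K : Matrix m m ℂ} (hK : K.IsHermitian) {r : ℝ}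
    (hr : r ∈ spectrum ℝ K) : Real.exp r ≤ (trace (exp K)).re := by
  rw [← CFC.real_exp_eq_normedSpace_exp (a := K) hK]
  exact le_re_trace_cfc hK (fun x => (Real.exp_pos x).le) hr

theorem re_trace_exp_nonneg {K : Matrix m m ℂ} (hK : K.IsHermitian) :
    0 ≤ (trace (exp K)).re :=
  (Complex.nonneg_iff.mp (IsSelfAdjoint.exp_nonneg hK).posSemidef.trace_nonneg).1

end TraceConvexity

section IndependentSampling

theorem exp_le_one_add_add_sq {𝔸 : Type*} [CStarAlgebra 𝔸] [PartialOrder 𝔸] [StarOrderedRing 𝔸]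
    {a : 𝔸} (ha : IsSelfAdjoint a) (hnorm : ‖a‖ ≤ 1) : exp a ≤ 1 + a + a ^ 2 := by
  have hpoly : 1 + a + a ^ 2 = cfc (fun x : ℝ => 1 + x + x ^ 2) a := by
    rw [cfc_add .., cfc_add .., cfc_const_one .., cfc_id' .., cfc_pow_id ..]
  rw [← CFC.real_exp_eq_normedSpace_exp ha, hpoly]
  refine cfc_mono fun x hx => ?_
  have : Nontrivial 𝔸 := (subsingleton_or_nontrivial 𝔸).resolve_left fun h => by
    simp [spectrum.of_subsingleton] at hx
  have hx1 : |x| ≤ 1 := (spectrum.norm_le_norm_of_mem hx).trans hnorm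
  linarith [(abs_le.mp (Real.abs_exp_sub_one_sub_id_le hx1)).2]

variable {ι m : Type*} [Fintype ι] [Fintype m] [DecidableEq m]

theorem expect_exp_le [Nonempty ι] {Y : ι → Matrix m m ℂ} (hY : ∀ i, (Y i).IsHermitian)
    (hnorm : ∀ i, ‖Y i‖ ≤ 1) (hmean : 𝔼 i, Y i = 0) {v : ℝ}
    (hv : 𝔼 i, Y i ^ 2 ≤ algebraMap ℝ _ v) : 𝔼 i, exp (Y i) ≤ algebraMap ℝ _ (Real.exp v) := by
  calc 𝔼 i, exp (Y i) ≤ 𝔼 i, (1 + Y i + Y i ^ 2) :=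
        Finset.expect_le_expect fun i _ => exp_le_one_add_add_sq (hY i) (hnorm i)
    _ = 1 + 𝔼 i, Y i ^ 2 := by
        rw [Finset.expect_add_distrib, Finset.expect_add_distrib, hmean, Fintype.expect_const,
          add_zero]
    _ ≤ algebraMap ℝ _ 1 + algebraMap ℝ _ v := by rw [map_one]; gcongr
    _ ≤ algebraMap ℝ _ (Real.exp v) := by
        rw [← map_add]
        exact algebraMap_mono _ (by linarith [Real.add_one_le_exp v])

theorem expect_re_trace_exp_add_le {Y : ι → Matrix m m ℂ} (hY : ∀ i, (Y i).IsHermitian) {c : ℝ}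
    (hc : 𝔼 i, exp (Y i) ≤ algebraMap ℝ _ c) {H : Matrix m m ℂ} (hH : H.IsHermitian) :
    𝔼 i, (trace (exp (Y i + H))).re ≤ c * (trace (exp H)).re := by
  calc 𝔼 i, (trace (exp (Y i + H))).re ≤ 𝔼 i, (trace (exp H * exp (Y i))).re :=
        Finset.expect_le_expect fun i _ => by
          rw [add_comm]; exact re_trace_exp_add_le hH (hY i)
    _ = (trace (exp H * 𝔼 i, exp (Y i))).re := by
        rw [Finset.mul_expect]
        exact (map_expect ((Complex.reLm ∘ₗ traceLinearMap m ℝ ℂ).restrictScalars ℚ≥0) _ _).symm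
    _ ≤ c * (trace (exp H)).re := re_trace_mul_le_of_le_algebraMap (IsSelfAdjoint.exp_nonneg hH) hc

theorem expect_fin_re_trace_exp_sum_le {Y : ι → Matrix m m ℂ} (hY : ∀ i, (Y i).IsHermitian)
    {c : ℝ} (hc : 𝔼 i, exp (Y i) ≤ algebraMap ℝ _ c) (hc0 : 0 ≤ c) (k : ℕ) :
    𝔼 f : Fin k → ι, (trace (exp (∑ j, Y (f j)))).re ≤ Fintype.card m * c ^ k := by
  induction k with
  | zero => simp
  | succ k ih =>
    calc 𝔼 f : Fin (k + 1) → ι, (trace (exp (∑ j, Y (f j)))).re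
        = 𝔼 p : ι × (Fin k → ι), (trace (exp (Y p.1 + ∑ j, Y (p.2 j)))).re :=
          (Fintype.expect_equiv (Fin.consEquiv fun _ => ι) _ _ fun p => by
            simp [Fin.sum_univ_succ]).symm
      _ = 𝔼 f : Fin k → ι, 𝔼 i, (trace (exp (Y i + ∑ j, Y (f j)))).re := by
          rw [← Finset.univ_product_univ, Finset.expect_product, Finset.expect_comm]
      _ ≤ 𝔼 f : Fin k → ι, c * (trace (exp (∑ j, Y (f j)))).re :=
          Finset.expect_le_expect fun f _ =>
            expect_re_trace_exp_add_le hY hc (isSelfAdjoint_sum _ fun j _ => hY (f j))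
      _ ≤ c * (Fintype.card m * c ^ k) := by rw [← Finset.mul_expect]; gcongr
      _ = Fintype.card m * c ^ (k + 1) := by ring

theorem expect_re_trace_exp_sum_le {κ : Type*} [Fintype κ] [DecidableEq κ]
    {Y : ι → Matrix m m ℂ} (hY : ∀ i, (Y i).IsHermitian) {c : ℝ}
    (hc : 𝔼 i, exp (Y i) ≤ algebraMap ℝ _ c) (hc0 : 0 ≤ c) :
    𝔼 f : κ → ι, (trace (exp (∑ k, Y (f k)))).re ≤ Fintype.card m * c ^ Fintype.card κ := by
  calc 𝔼 f : κ → ι, (trace (exp (∑ k, Y (f k)))).re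
      = 𝔼 f : Fin (Fintype.card κ) → ι, (trace (exp (∑ j, Y (f j)))).re :=
        Fintype.expect_equiv ((Fintype.equivFin κ).arrowCongr (.refl ι)) _ _ fun f => by
          rw [← (Fintype.equivFin κ).sum_comp]; simp
    _ ≤ Fintype.card m * c ^ Fintype.card κ := expect_fin_re_trace_exp_sum_le hY hc hc0 _

end IndependentSampling

section Hoeffding

open Equiv (Perm)

theorem sum_perm_apply_eq {κ E : Type*} [Fintype κ] [DecidableEq κ] [AddCommMonoid E] (Y : κ → E)
    (k l : κ) : ∑ π : Perm κ, Y (π k) = ∑ π : Perm κ, Y (π l) := by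
  simpa using (Equiv.sum_comp (Equiv.mulRight (Equiv.swap k l)) fun π : Perm κ => Y (π k)).symm

theorem expect_perm_apply {κ E : Type*} [Fintype κ] [DecidableEq κ] [AddCommMonoid E]
    [Module ℚ≥0 E] (Y : κ → E) (k : κ) : 𝔼 π : Perm κ, Y (π k) = 𝔼 l, Y l := by
  have : Nonempty κ := ⟨k⟩
  calc 𝔼 π : Perm κ, Y (π k) = 𝔼 l, 𝔼 π : Perm κ, Y (π l) := by
        rw [← Fintype.expect_const (ι := κ) (𝔼 π : Perm κ, Y (π k))]
        refine Finset.expect_congr rfl fun l _ => ?_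
        rw [Finset.expect, sum_perm_apply_eq Y k l, Finset.expect]
    _ = 𝔼 π : Perm κ, 𝔼 l, Y (π l) := Finset.expect_comm _ _ _
    _ = 𝔼 l, Y l := by
        rw [← Fintype.expect_const (ι := Perm κ) (𝔼 l, Y l)]
        exact Finset.expect_congr rfl fun π _ => Fintype.expect_equiv π _ _ fun _ => rfl

theorem exists_perm_comp_eq_comp {ι κ : Type*} [Finite ι] [Finite κ] (B : κ ↪ ι) (f : κ → ι) :
    ∃ (ρ : Perm ι) (g : κ → κ), ρ ∘ f = B ∘ g := by
  classical
  have := Fintype.ofFinite ι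
  have := Fintype.ofFinite κ
  obtain ⟨t, ht, hcard⟩ := Finset.exists_subset_card_eq
    (s := Finset.univ.map B) (n := (Finset.univ.image f).card)
    (by simpa using Finset.card_image_le (s := Finset.univ) (f := f))
  let e : {x // x ∈ Finset.univ.image f} ≃ {x // x ∈ t} := Finset.equivOfCardEq hcard.symm
  have hmem (k : κ) : ∃ l, B l = e.extendSubtype (f k) := by
    simpa using ht (e.extendSubtype_mem (f k) (by simp))
  choose g hg using hmem
  exact ⟨e.extendSubtype, g, funext fun k => (hg k).symm⟩

theorem expect_eq_inv_card_smul_sum {ι E : Type*} (𝕜 : Type*) [DivisionSemiring 𝕜] [CharZero 𝕜]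
    [AddCommMonoid E] [Module ℚ≥0 E] [Module 𝕜 E] (s : Finset ι) (f : ι → E) :
    𝔼 i ∈ s, f i = (s.card : 𝕜)⁻¹ • ∑ i ∈ s, f i := by
  rw [Finset.expect, ← NNRat.cast_smul_eq_nnqsmul 𝕜]
  simp

theorem map_expect_le_of_convexOn {ι E : Type*} [AddCommGroup E] [Module ℝ E] [Module ℚ≥0 E]
    {s : Set E} {φ : E → ℝ} (hφ : ConvexOn ℝ s φ) {t : Finset ι} (ht : t.Nonempty) {x : ι → E}
    (hx : ∀ i ∈ t, x i ∈ s) : φ (𝔼 i ∈ t, x i) ≤ 𝔼 i ∈ t, φ (x i) := by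
  have hcard : (t.card : ℝ) ≠ 0 := Nat.cast_ne_zero.mpr ht.card_ne_zero
  have jensen := hφ.map_sum_le (t := t) (w := fun _ => (t.card : ℝ)⁻¹) (p := x)
    (fun _ _ => by positivity) (by simp [hcard]) hx
  rwa [expect_eq_inv_card_smul_sum ℝ, expect_eq_inv_card_smul_sum ℝ, Finset.smul_sum,
    Finset.smul_sum]

variable {ι κ E : Type*} [Fintype ι] [DecidableEq ι] [Fintype κ]
  [AddCommGroup E] [Module ℝ E] [Module ℚ≥0 E]

-- Some permutation of `ι` moves the values of `f` into the range of `B`, so the right-hand side is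
-- unchanged when the sample is moreover scrambled by a random permutation of that range; averaging
-- over the scrambling inside `φ` recovers the sample without repetitions.
theorem expect_perm_embedding_le (B : κ ↪ ι) (f : κ → ι) {s : Set E} {φ : E → ℝ}
    (hφ : ConvexOn ℝ s φ) {X : ι → E} (hX : ∀ g : κ → ι, ∑ k, X (g k) ∈ s) :
    𝔼 σ : Perm ι, φ (∑ k, X (σ (B k))) ≤ 𝔼 σ : Perm ι, φ (∑ k, X (σ (f k))) := by
  classical
  obtain ⟨ρ, g, hρ⟩ := exists_perm_comp_eq_comp B f
  have hscramble (π : Perm κ) : 𝔼 σ : Perm ι, φ (∑ k, X (σ (f k))) =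
      𝔼 σ : Perm ι, φ (∑ k, X (σ (B (π (g k))))) := by
    refine .symm <|
      Fintype.expect_equiv (Equiv.mulRight (π.viaFintypeEmbedding B * ρ)) _ _ fun σ => ?_
    have h (k : κ) : ρ (f k) = B (g k) := congrFun hρ k
    simp [h, Perm.viaFintypeEmbedding_apply_image]
  have hmean (σ : Perm ι) : 𝔼 π : Perm κ, ∑ k, X (σ (B (π (g k)))) = ∑ k, X (σ (B k)) := by
    rw [Finset.expect_sum_comm]
    simp only [expect_perm_apply fun l => X (σ (B l))]
    rw [Finset.sum_const, Finset.card_univ, Fintype.card_smul_expect]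
  calc 𝔼 σ : Perm ι, φ (∑ k, X (σ (B k)))
      ≤ 𝔼 σ : Perm ι, 𝔼 π : Perm κ, φ (∑ k, X (σ (B (π (g k))))) :=
        Finset.expect_le_expect fun σ _ => by
          rw [← hmean σ]
          exact map_expect_le_of_convexOn hφ Finset.univ_nonempty fun π _ =>
            hX fun k => σ (B (π (g k)))
    _ = 𝔼 π : Perm κ, 𝔼 σ : Perm ι, φ (∑ k, X (σ (f k))) := by
        rw [Finset.expect_comm]; simp only [← hscramble]
    _ = 𝔼 σ : Perm ι, φ (∑ k, X (σ (f k))) := Fintype.expect_const _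

theorem expect_perm_embedding_le_expect_pi [DecidableEq κ] (B : κ ↪ ι) {s : Set E} {φ : E → ℝ}
    (hφ : ConvexOn ℝ s φ) {X : ι → E} (hX : ∀ g : κ → ι, ∑ k, X (g k) ∈ s) :
    𝔼 σ : Perm ι, φ (∑ k, X (σ (B k))) ≤ 𝔼 f : κ → ι, φ (∑ k, X (f k)) := by
  have : Nonempty (κ → ι) := ⟨B⟩
  calc 𝔼 σ : Perm ι, φ (∑ k, X (σ (B k)))
      = 𝔼 _f : κ → ι, 𝔼 σ : Perm ι, φ (∑ k, X (σ (B k))) := (Fintype.expect_const _).symm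
    _ ≤ 𝔼 f : κ → ι, 𝔼 σ : Perm ι, φ (∑ k, X (σ (f k))) :=
        Finset.expect_le_expect fun f _ => expect_perm_embedding_le B f hφ hX
    _ = 𝔼 σ : Perm ι, 𝔼 f : κ → ι, φ (∑ k, X (f k)) := by
        rw [Finset.expect_comm]
        exact Finset.expect_congr rfl fun σ _ =>
          Fintype.expect_equiv ((Equiv.refl κ).arrowCongr σ) _ _ fun f => by simp
    _ = 𝔼 f : κ → ι, φ (∑ k, X (f k)) := Fintype.expect_const _

end Hoeffding

section Dilation

variable {m n : Type*}

/-- The Hermitian dilation `[[0, M], [Mᴴ, 0]]` of a rectangular matrix, which reduces norm bounds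
for arbitrary matrices to the Hermitian case. It is only real linear, because of the conjugate
transpose. -/
def hermitianDilation : Matrix m n ℂ →ₗ[ℝ] Matrix (m ⊕ n) (m ⊕ n) ℂ where
  toFun M := fromBlocks 0 M Mᴴ 0
  map_add' M N := by simp [fromBlocks_add]
  map_smul' t M := by simp [fromBlocks_smul]

theorem hermitianDilation_apply (M : Matrix m n ℂ) :
    hermitianDilation M = fromBlocks 0 M Mᴴ 0 := rfl

theorem isHermitian_hermitianDilation (M : Matrix m n ℂ) : (hermitianDilation M).IsHermitian :=
  isHermitian_zero.fromBlocks rfl isHermitian_zero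

theorem hermitianDilation_sq [Fintype m] [Fintype n] [DecidableEq m] [DecidableEq n]
    (M : Matrix m n ℂ) :
    hermitianDilation M ^ 2 = fromBlocks (M * Mᴴ) 0 0 (Mᴴ * M) := by
  simp [sq, hermitianDilation_apply, fromBlocks_multiply]

theorem fromBlocks_nonneg_iff [Finite m] [Finite n] {P : Matrix m m ℂ} {Q : Matrix n n ℂ} :
    0 ≤ fromBlocks P 0 0 Q ↔ 0 ≤ P ∧ 0 ≤ Q := by
  classical
  have := Fintype.ofFinite m
  have := Fintype.ofFinite n
  constructor
  · intro h
    exact ⟨by simpa using! (h.posSemidef.submatrix Sum.inl).nonneg,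
      by simpa using! (h.posSemidef.submatrix Sum.inr).nonneg⟩
  · rintro ⟨hP, hQ⟩
    obtain ⟨C, rfl⟩ := CStarAlgebra.nonneg_iff_eq_star_mul_self.mp hP
    obtain ⟨D, rfl⟩ := CStarAlgebra.nonneg_iff_eq_star_mul_self.mp hQ
    convert star_mul_self_nonneg (fromBlocks C 0 0 D)
    simp [star_eq_conjTranspose, fromBlocks_conjTranspose, fromBlocks_multiply]

variable [Fintype m] [Fintype n] [DecidableEq m] [DecidableEq n]

theorem fromBlocks_le_algebraMap_iff {P : Matrix m m ℂ} {Q : Matrix n n ℂ} {c : ℝ} :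
    fromBlocks P 0 0 Q ≤ algebraMap ℝ _ c ↔ P ≤ algebraMap ℝ _ c ∧ Q ≤ algebraMap ℝ _ c := by
  have h : algebraMap ℝ (Matrix (m ⊕ n) (m ⊕ n) ℂ) c - fromBlocks P 0 0 Q =
      fromBlocks (algebraMap ℝ _ c - P) 0 0 (algebraMap ℝ _ c - Q) := by
    simp only [Algebra.algebraMap_eq_smul_one, ← fromBlocks_one, fromBlocks_smul, sub_eq_add_neg,
      fromBlocks_neg, fromBlocks_add, smul_zero, neg_zero, add_zero]
  rw [← sub_nonneg, h, fromBlocks_nonneg_iff, sub_nonneg, sub_nonneg]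

theorem norm_hermitianDilation_le_iff {M : Matrix m n ℂ} {c : ℝ} (hc : 0 ≤ c) :
    ‖hermitianDilation M‖ ≤ c ↔ ‖M‖ ≤ c := by
  have norm_mul_conjTranspose : ‖M * Mᴴ‖ = ‖M‖ * ‖M‖ := by
    simpa [l2_opNorm_conjTranspose] using l2_opNorm_conjTranspose_mul_self Mᴴ
  have hM : IsSelfAdjoint (hermitianDilation M) := isHermitian_hermitianDilation M
  calc ‖hermitianDilation M‖ ≤ c ↔ ‖hermitianDilation M ^ 2‖ ≤ c * c := by
        rw [sq, hM.norm_mul_self, sq, ← mul_self_le_mul_self_iff (norm_nonneg _) hc]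
    _ ↔ M * Mᴴ ≤ algebraMap ℝ _ (c * c) ∧ Mᴴ * M ≤ algebraMap ℝ _ (c * c) := by
        rw [CStarAlgebra.norm_le_iff_le_algebraMap _ (mul_self_nonneg c) hM.sq_nonneg,
          hermitianDilation_sq, fromBlocks_le_algebraMap_iff]
    _ ↔ ‖M‖ ≤ c := by
        rw [← CStarAlgebra.norm_le_iff_le_algebraMap _ (mul_self_nonneg c)
            (posSemidef_self_mul_conjTranspose M).nonneg,
          ← CStarAlgebra.norm_le_iff_le_algebraMap _ (mul_self_nonneg c)
            (posSemidef_conjTranspose_mul_self M).nonneg,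
          norm_mul_conjTranspose, l2_opNorm_conjTranspose_mul_self, and_self,
          ← mul_self_le_mul_self_iff (norm_nonneg _) hc]

theorem norm_hermitianDilation (M : Matrix m n ℂ) : ‖hermitianDilation M‖ = ‖M‖ :=
  le_antisymm ((norm_hermitianDilation_le_iff (norm_nonneg _)).mpr le_rfl)
    ((norm_hermitianDilation_le_iff (norm_nonneg _)).mp le_rfl)

theorem hermitianDilation_sq_le (M : Matrix m n ℂ) :
    hermitianDilation M ^ 2 ≤ algebraMap ℝ _ (‖M‖ ^ 2) := by
  have hM : IsSelfAdjoint (hermitianDilation M) := isHermitian_hermitianDilation M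
  simpa only [sq, hM.norm_mul_self, norm_hermitianDilation] using (hM.pow 2).le_algebraMap_norm_self

theorem trace_exp_neg_hermitianDilation (M : Matrix m n ℂ) :
    trace (exp (-hermitianDilation M)) = trace (exp (hermitianDilation M)) := by
  let U : (Matrix (m ⊕ n) (m ⊕ n) ℂ)ˣ :=
    ⟨fromBlocks 1 0 0 (-1), fromBlocks 1 0 0 (-1), by simp [fromBlocks_multiply],
      by simp [fromBlocks_multiply]⟩
  have h : -hermitianDilation M = U * hermitianDilation M * U⁻¹ := by
    simp [U, hermitianDilation_apply, fromBlocks_multiply, fromBlocks_neg]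
  rw [h, Matrix.exp_units_conj, trace_units_conj]

theorem exp_norm_le_re_trace_exp_hermitianDilation [Nonempty (m ⊕ n)] (M : Matrix m n ℂ) :
    Real.exp ‖M‖ ≤ (trace (exp (hermitianDilation M))).re := by
  have hM := isHermitian_hermitianDilation M
  rcases CStarAlgebra.norm_or_neg_norm_mem_spectrum hM.isSelfAdjoint with h | h
  · exact norm_hermitianDilation M ▸ exp_le_re_trace_exp hM h
  · rw [← trace_exp_neg_hermitianDilation, ← norm_hermitianDilation]
    exact exp_le_re_trace_exp hM.neg (by rwa [← spectrum.neg_eq, Set.mem_neg])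

end Dilation

section Concentration

open MeasureTheory
open Equiv (Perm)

theorem expect_sub_expect_sq_le {ι R : Type*} [Fintype ι] [Nonempty ι] [Ring R] [PartialOrder R]
    [StarRing R] [StarOrderedRing R] [Algebra ℚ≥0 R] {Y : ι → R}
    (hY : IsSelfAdjoint (𝔼 i, Y i)) : 𝔼 i, (Y i - 𝔼 j, Y j) ^ 2 ≤ 𝔼 i, Y i ^ 2 := by
  have variance : 𝔼 i, (Y i - 𝔼 j, Y j) ^ 2 = 𝔼 i, Y i ^ 2 - (𝔼 i, Y i) ^ 2 := by
    simp only [sq, sub_mul, mul_sub, Finset.expect_sub_distrib, ← Finset.mul_expect,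
      ← Finset.expect_mul, Fintype.expect_const]
    abel
  rw [variance]
  exact sub_le_self _ hY.sq_nonneg

theorem norm_sub_expect_le {ι E : Type*} [Fintype ι] [SeminormedAddCommGroup E] [NormedSpace ℝ E]
    [Module ℚ≥0 E] {M : ι → E} {L : ℝ} (hL : ∀ i, ‖M i‖ ≤ L) (i : ι) :
    ‖M i - 𝔼 j, M j‖ ≤ 2 * L := by
  have norm_mean_le : ‖𝔼 j, M j‖ ≤ L :=
    calc ‖𝔼 j, M j‖ ≤ 𝔼 j, ‖M j‖ :=
          Finset.le_expect_of_subadditive norm_zero norm_add_le fun q x => by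
            rw [← NNRat.cast_smul_eq_nnqsmul ℝ, norm_smul, ← NNRat.cast_smul_eq_nnqsmul ℝ]
            simp
      _ ≤ L := Finset.expect_le ⟨i, Finset.mem_univ i⟩ fun j _ => hL j
  linarith [norm_sub_le (M i) (𝔼 j, M j), hL i]

theorem integral_uniformOfFintype {α E : Type*} [Fintype α] [Nonempty α] [MeasurableSpace α]
    [MeasurableSingletonClass α] [NormedAddCommGroup E] [NormedSpace ℝ E] [CompleteSpace E]
    [Module ℚ≥0 E] (f : α → E) :
    ∫ x, f x ∂(PMF.uniformOfFintype α).toMeasure = 𝔼 x, f x := by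
  simp [PMF.integral_eq_sum, expect_eq_inv_card_smul_sum ℝ, Finset.smul_sum]

variable {ι κ m n : Type*} [Fintype ι] [Fintype κ] [Fintype m] [Fintype n]
  [DecidableEq n] {M : ι → Matrix m n ℂ}

theorem expect_hermitianDilation_sub_sq_le [DecidableEq m] [Nonempty ι] (M : ι → Matrix m n ℂ) :
    𝔼 i, hermitianDilation (M i - 𝔼 j, M j) ^ 2 ≤ algebraMap ℝ _ (𝔼 i, ‖M i‖ ^ 2) := by
  have map_mean : hermitianDilation (𝔼 i, M i) = 𝔼 i, hermitianDilation (M i) :=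
    map_expect (hermitianDilation.restrictScalars ℚ≥0) _ _
  calc 𝔼 i, hermitianDilation (M i - 𝔼 j, M j) ^ 2
      = 𝔼 i, (hermitianDilation (M i) - 𝔼 j, hermitianDilation (M j)) ^ 2 := by
        simp only [map_sub, map_mean]
    _ ≤ 𝔼 i, hermitianDilation (M i) ^ 2 :=
        expect_sub_expect_sq_le (map_mean ▸ isHermitian_hermitianDilation _)
    _ ≤ 𝔼 i, algebraMap ℝ _ (‖M i‖ ^ 2) :=
        Finset.expect_le_expect fun i _ => hermitianDilation_sq_le (M i)
    _ = algebraMap ℝ _ (𝔼 i, ‖M i‖ ^ 2) :=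
        (map_expect ((Algebra.linearMap ℝ (Matrix (m ⊕ n) (m ⊕ n) ℂ)).restrictScalars ℚ≥0) _ _).symm

theorem expect_perm_re_trace_exp_hermitianDilation_le [DecidableEq m] [Nonempty ι] [DecidableEq ι]
    (B : κ ↪ ι) {L θ : ℝ} (hL : ∀ i, ‖M i‖ ≤ L) (hθ : 0 ≤ θ) (hθL : θ * (2 * L) ≤ 1) :
    𝔼 σ : Perm ι,
        (trace (exp (hermitianDilation (∑ k, θ • (M (σ (B k)) - 𝔼 i, M i))))).re ≤
      (Fintype.card m + Fintype.card n) *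
        Real.exp (Fintype.card κ * (θ ^ 2 * 𝔼 i, ‖M i‖ ^ 2)) := by
  classical
  let Y : ι → Matrix (m ⊕ n) (m ⊕ n) ℂ := fun i => hermitianDilation (θ • (M i - 𝔼 j, M j))
  have hY (i : ι) : (Y i).IsHermitian := isHermitian_hermitianDilation _
  have hnorm (i : ι) : ‖Y i‖ ≤ 1 := by
    rw [norm_hermitianDilation, norm_smul, Real.norm_of_nonneg hθ]
    exact (mul_le_mul_of_nonneg_left (norm_sub_expect_le hL i) hθ).trans hθL
  have hmean : 𝔼 i, Y i = 0 := by
    have h : 𝔼 i, Y i = hermitianDilation (𝔼 i, θ • (M i - 𝔼 j, M j)) :=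
      (map_expect (hermitianDilation.restrictScalars ℚ≥0) _ _).symm
    rw [h, ← Finset.smul_expect, Finset.expect_sub_distrib, Fintype.expect_const, sub_self,
      smul_zero, map_zero]
  have hvar : 𝔼 i, Y i ^ 2 ≤ algebraMap ℝ _ (θ ^ 2 * 𝔼 i, ‖M i‖ ^ 2) := by
    simp only [Y, map_smul, smul_pow, ← Finset.smul_expect, map_mul, ← Algebra.smul_def]
    exact smul_le_smul_of_nonneg_left (expect_hermitianDilation_sub_sq_le M) (sq_nonneg θ)
  simp only [map_sum]
  calc 𝔼 σ : Perm ι, (trace (exp (∑ k, Y (σ (B k))))).re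
      ≤ 𝔼 f : κ → ι, (trace (exp (∑ k, Y (f k)))).re :=
        expect_perm_embedding_le_expect_pi B convexOn_re_trace_exp fun g =>
          isSelfAdjoint_sum _ fun k _ => hY (g k)
    _ ≤ Fintype.card (m ⊕ n) * Real.exp (θ ^ 2 * 𝔼 i, ‖M i‖ ^ 2) ^ Fintype.card κ :=
        expect_re_trace_exp_sum_le hY (expect_exp_le hY hnorm hmean hvar) (Real.exp_nonneg _)
    _ = _ := by rw [Fintype.card_sum, Nat.cast_add, Real.exp_nat_mul]

variable [DecidableEq ι] [MeasurableSpace (Perm ι)] [MeasurableSingletonClass (Perm ι)]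
  [Nonempty κ] [Nonempty (m ⊕ n)]

theorem measureReal_lt_norm_expect_perm_sub_expect_le (B : κ ↪ ι) {L v θ : ℝ}
    (hL : ∀ i, ‖M i‖ ≤ L) (hv : 𝔼 i, ‖M i‖ ^ 2 ≤ v) (hθ : 0 ≤ θ) (hθL : θ * (2 * L) ≤ 1) (ε : ℝ) :
    (PMF.uniformOfFintype (Perm ι)).toMeasure.real
        {σ | ε < ‖𝔼 k, M (σ (B k)) - 𝔼 i, M i‖} ≤
      (Fintype.card m + Fintype.card n) * Real.exp (Fintype.card κ * (θ ^ 2 * v - θ * ε)) := by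
  have : Nonempty ι := ⟨B (Classical.arbitrary κ)⟩
  classical
  let a : ℝ := Fintype.card κ
  let S (σ : Perm ι) : Matrix m n ℂ := ∑ k, θ • (M (σ (B k)) - 𝔼 i, M i)
  let F (σ : Perm ι) : ℝ := (trace (exp (hermitianDilation (S σ)))).re
  have norm_S (σ : Perm ι) : ‖S σ‖ = a * (θ * ‖𝔼 k, M (σ (B k)) - 𝔼 i, M i‖) := by
    have h : S σ = (θ * a) • (𝔼 k, M (σ (B k)) - 𝔼 i, M i) := by
      rw [← Fintype.expect_const (ι := κ) (𝔼 i, M i), ← Finset.expect_sub_distrib, mul_smul,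
        Nat.cast_smul_eq_nsmul, Fintype.card_smul_expect, Finset.smul_sum]
    rw [h, norm_smul, Real.norm_of_nonneg (by positivity)]
    ring
  have subset : {σ | ε < ‖𝔼 k, M (σ (B k)) - 𝔼 i, M i‖} ⊆ {σ | Real.exp (a * (θ * ε)) ≤ F σ} := by
    intro σ hσ
    calc Real.exp (a * (θ * ε)) ≤ Real.exp ‖S σ‖ := by
          rw [norm_S]; have : ε ≤ _ := le_of_lt hσ; gcongr
      _ ≤ F σ := exp_norm_le_re_trace_exp_hermitianDilation _
  have markov : Real.exp (a * (θ * ε)) * (PMF.uniformOfFintype (Perm ι)).toMeasure.real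
      {σ | Real.exp (a * (θ * ε)) ≤ F σ} ≤ 𝔼 σ, F σ := by
    rw [← integral_uniformOfFintype]
    exact mul_meas_ge_le_integral_of_nonneg
      (.of_forall fun σ => re_trace_exp_nonneg (isHermitian_hermitianDilation _)) .of_finite _
  have mgf : 𝔼 σ, F σ ≤
      (Fintype.card m + Fintype.card n) * Real.exp (a * (θ ^ 2 * v)) :=
    (expect_perm_re_trace_exp_hermitianDilation_le B hL hθ hθL).trans (by gcongr)
  rw [mul_sub, Real.exp_sub, ← mul_div_assoc, le_div_iff₀' (Real.exp_pos _)]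
  exact (mul_le_mul_of_nonneg_left (measureReal_mono subset) (Real.exp_nonneg _)).trans
    (markov.trans mgf)

theorem measureReal_lt_norm_expect_perm_sub_expect_le_exp_neg (B : κ ↪ ι) {L v ε : ℝ}
    (hL : ∀ i, ‖M i‖ ≤ L) (hv : 𝔼 i, ‖M i‖ ^ 2 ≤ v) (hv0 : 0 < v) (hε : 0 ≤ ε)
    (hεL : ε * L ≤ 3 * v) :
    (PMF.uniformOfFintype (Perm ι)).toMeasure.real
        {σ | ε < ‖𝔼 k, M (σ (B k)) - 𝔼 i, M i‖} ≤
      (Fintype.card m + Fintype.card n) * Real.exp (-(Fintype.card κ * ε ^ 2 / 12) / v) := by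
  have hθL : ε / (6 * v) * (2 * L) ≤ 1 := by
    rw [div_mul_eq_mul_div, div_le_one (by positivity)]
    linarith
  refine (measureReal_lt_norm_expect_perm_sub_expect_le B hL hv (by positivity) hθL ε).trans ?_
  gcongr
  have exponent : (Fintype.card κ : ℝ) * ((ε / (6 * v)) ^ 2 * v - ε / (6 * v) * ε) =
      -(5 / 36 * (Fintype.card κ * ε ^ 2 / v)) := by field_simp; ring
  have : 0 ≤ (Fintype.card κ : ℝ) * ε ^ 2 / v := by positivity
  rw [exponent, neg_div, div_right_comm]
  linarith

end Concentration

section TriangularArrays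

variable {d : ℕ} (A : TriArray d)

theorem card_block {a n j : ℕ} (hj : j < numBlocks a n) : (block a n j).card = a := by
  have hle : j * a + a ≤ n := Nat.succ_mul j a ▸ Nat.mul_le_of_le_div a (j + 1) n hj
  have hmap : (block a n j).map Fin.valEmbedding = Finset.Ico (j * a) (j * a + a) := by
    ext i
    simp only [block, Finset.mem_map, Finset.mem_filter_univ, Fin.valEmbedding_apply,
      Finset.mem_Ico]
    exact ⟨by rintro ⟨k, hk, rfl⟩; exact hk, fun hi => ⟨⟨i, by omega⟩, hi, rfl⟩⟩
  rw [← Finset.card_map Fin.valEmbedding, hmap, Nat.card_Ico, Nat.add_sub_cancel_left]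

theorem blockAvg_eq_expect {a n j : ℕ} (hj : j < numBlocks a n) (σ : Equiv.Perm (Fin n)) :
    blockAvg A a n j σ = 𝔼 i : block a n j, A n (σ i) := by
  rw [expect_eq_inv_card_smul_sum ℂ, Finset.card_univ, Fintype.card_coe, card_block hj,
    Finset.sum_coe_sort (block a n j) fun i => A n (σ i), blockAvg, one_div]

theorem rowAvg_eq_expect (n : ℕ) : rowAvg A n = 𝔼 i, A n i := by
  rw [expect_eq_inv_card_smul_sum ℂ, Finset.card_fin, rowAvg, one_div]

theorem LOne_eq_expect (n : ℕ) : LOne A n = 𝔼 i, ‖A n i‖ := by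
  rw [expect_eq_inv_card_smul_sum ℝ, Finset.card_fin, LOne, one_div, smul_eq_mul]

variable {A}

theorem norm_le_LInf (n : ℕ) (i : Fin n) : ‖A n i‖ ≤ LInf A n :=
  le_ciSup (f := fun i => ‖A n i‖) (Set.finite_range _).bddAbove i

theorem LInf_nonneg (n : ℕ) : 0 ≤ LInf A n :=
  Real.iSup_nonneg fun _ => norm_nonneg _

theorem LOne_le_LInf (n : ℕ) : LOne A n ≤ LInf A n := by
  rw [LOne_eq_expect]
  rcases (Finset.univ : Finset (Fin n)).eq_empty_or_nonempty with h | h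
  · simpa [h] using LInf_nonneg n
  · exact Finset.expect_le h fun i _ => norm_le_LInf n i

theorem expect_norm_sq_le_LOne_mul_LInf (n : ℕ) : 𝔼 i, ‖A n i‖ ^ 2 ≤ LOne A n * LInf A n := by
  rw [LOne_eq_expect, Finset.expect_mul]
  refine Finset.expect_le_expect fun i _ => ?_
  rw [sq]
  exact mul_le_mul_of_nonneg_left (norm_le_LInf n i) (norm_nonneg _)

theorem uniformPerm_real_lt_norm_blockAvg_sub_rowAvg_le {a n : ℕ} (ha : 0 < a) {ε : ℝ}
    (hε : 0 < ε) (hεL : ε < 3 * LOne A n) {j : ℕ} (hj : j < numBlocks a n) :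
    (uniformPerm n).real {σ | ε < ‖blockAvg A a n j σ - rowAvg A n‖} ≤
      2 * d * Real.exp (-(a * ε ^ 2 / 12) / (LOne A n * LInf A n)) := by
  have hL1 : 0 < LOne A n := by linarith
  have hLInf : 0 < LInf A n := hL1.trans_le (LOne_le_LInf n)
  have : Nonempty (Fin d) := not_isEmpty_iff.mp fun _ => by
    simp [LOne, Subsingleton.elim (A n _) 0] at hL1
  have : Nonempty (block a n j) := by
    rw [Finset.nonempty_coe_sort, ← Finset.card_pos, card_block hj]
    exact ha
  have tail := measureReal_lt_norm_expect_perm_sub_expect_le_exp_neg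
    (.subtype (· ∈ block a n j)) (norm_le_LInf n) (expect_norm_sq_le_LOne_mul_LInf n)
    (mul_pos hL1 hLInf) hε.le (by nlinarith)
  simp only [Function.Embedding.coe_subtype, Fintype.card_coe, card_block hj, Fintype.card_fin,
    ← two_mul] at tail
  simpa only [blockAvg_eq_expect A hj, rowAvg_eq_expect, uniformPerm] using tail

end TriangularArrays

end RandomPerm

theorem mainTheorem4 (d : ℕ) (A : RandomPerm.TriArray d) (a : ℕ → ℕ) (ha : ∀ n, 0 < a n)
    (n : ℕ) (ε : ℝ) (hε : 0 < ε) (hεL : ε < 3 * RandomPerm.LOne A n) :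
    (RandomPerm.uniformPerm n).real
        {σ | ∃ j : Fin (RandomPerm.numBlocks (a n) n),
          ε < ‖RandomPerm.blockAvg A (a n) n j σ - RandomPerm.rowAvg A n‖} ≤
      (RandomPerm.numBlocks (a n) n : ℝ) * (2 * (d : ℝ)) *
        Real.exp (-((a n : ℝ) * ε ^ 2 / 12) / (RandomPerm.LOne A n * RandomPerm.LInf A n)) := by
  rw [Set.ofPred_exists]
  refine (MeasureTheory.measureReal_iUnion_fintype_le _).trans ?_
  refine (Finset.sum_le_sum fun j _ =>
    RandomPerm.uniformPerm_real_lt_norm_blockAvg_sub_rowAvg_le (ha n) hε hεL j.isLt).trans_eq ?_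
  simp [mul_assoc]
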